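/- Let $E$ be a (real or complex) Banach space and $L$ a Hilbert space over the same field, and suppose that $E\subseteq L$ with continuous inclusion of dense range. Write $\langle\cdot,\cdot\rangle$ for the inner product of $L$. A bounded operator $A$ on $E$ is called *proper* if for every $f\in E$ there is $g\in E$ with $\langle Ah,f\rangle=\langle h,g\rangle$ for all $h\in E$; then $g$ is unique, $A^+f:=g$ defines a bounded operator $A^+$ on $E$, and the set $\mathfrak P$ of all proper operators is a unital algebra with the norm $\|A\|_{\mathfrak P}:=\|A\|_{\mathcal B(E)}+\|A^+\|_{\mathcal B(E)}$. Let $\mathfrak P^\times$ be the group of invertible elements of $\mathfrak P$. A closed subspace of $E$ is *proper* if it is the range of a projection $Q\in\mathfrak P$, and *compatible* if it is the range of a projection $Q\in\mathfrak P$ with $Q^+=Q$. For a subspace $M\subseteq E$ let $M^\perp\cap E=\{f\in E:\langle f,g\rangle=0\ \forall g\in M\}$. A *proper companion* of a proper subspace $S$ is a closed subspace $T$ of $E$ such that $$S\,\dot+\,T=(S^\perp\cap E)\,\dot+\,(T^\perp\cap E)=E$$ (direct sums); in that case the projection $P_{T//S}$ with range $T$ and nullspace $S$ belongs to $\mathfrak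 P$. Let $S$ be a proper subspace of $E$ and $T$ a proper companion of $S$, and suppose that $S$ and $T$ are both compatible. Then: (i) There is a constant $r>0$ (depending only on $S$ and $T$) such that every proper companion $T_1$ of $S$ with $\|P_{T//S}-P_{T_1//S}\|_{\mathfrak P}<r$ is compatible. (ii) If $G\in\mathfrak P^\times$ is such that $G-I$ and $G^+-I$ are compact operators on $E$, then $G(S)$ and $G(T)$ are compatible subspaces. -/

import Mathlib

open Filter Topology

/-- A continuous and dense inclusion of a normed space `E` into an inner product space `L`.
The elements of `E` are regarded as vectors of `L` through `incl`. -/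
structure DenseInclusion (𝕜 E L : Type*) [RCLike 𝕜] [NormedAddCommGroup E] [NormedSpace 𝕜 E]
    [NormedAddCommGroup L] [InnerProductSpace 𝕜 L] where
  /-- the underlying bounded linear map -/
  incl : E →L[𝕜] L
  injective : Function.Injective incl
  denseRange : DenseRange incl

namespace DenseInclusion

variable {𝕜 E L : Type*} [RCLike 𝕜] [NormedAddCommGroup E] [NormedSpace 𝕜 E]
  [NormedAddCommGroup L] [InnerProductSpace 𝕜 L]

/-- A bounded operator `T` on `E` is proper if for every `f` in `E` there is `g` in `E` with
`⟪T h, f⟫ = ⟪h, g⟫` for all `h` in `E`, the inner product being that of `L`. -/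
def IsProper (ι : DenseInclusion 𝕜 E L) (T : E →L[𝕜] E) : Prop :=
  ∀ f : E, ∃ g : E, ∀ h : E, inner 𝕜 (ι.incl (T h)) (ι.incl f) = inner 𝕜 (ι.incl h) (ι.incl g)

theorem ext_inner (ι : DenseInclusion 𝕜 E L) {g₁ g₂ : E}
    (H : ∀ h : E, inner 𝕜 (ι.incl h) (ι.incl g₁) = inner 𝕜 (ι.incl h) (ι.incl g₂)) :
    g₁ = g₂ := by
  have h0 : inner 𝕜 (ι.incl (g₁ - g₂)) (ι.incl (g₁ - g₂)) = (0 : 𝕜) := by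
    conv_lhs => rw [map_sub ι.incl g₁ g₂, inner_sub_right]
    rw [← map_sub, H (g₁ - g₂), sub_self]
  have h1 : ι.incl (g₁ - g₂) = ι.incl 0 := by
    rw [map_zero]; exact inner_self_eq_zero.mp h0
  exact sub_eq_zero.mp (ι.injective h1)

/-- The algebra `𝔓` of proper operators. -/
def properAlgebra (ι : DenseInclusion 𝕜 E L) : Subalgebra 𝕜 (E →L[𝕜] E) where
  carrier := {T | ι.IsProper T}
  mul_mem' := by
    intro A B hA hB f
    obtain ⟨g, hg⟩ := hA f
    obtain ⟨k, hk⟩ := hB g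
    exact ⟨k, fun h => by rw [← hk h, ← hg (B h)]; rfl⟩
  add_mem' := by
    intro A B hA hB f
    obtain ⟨g, hg⟩ := hA f
    obtain ⟨k, hk⟩ := hB f
    exact ⟨g + k, fun h => by
      rw [add_apply, map_add, map_add, inner_add_left, inner_add_right,
        hg h, hk h]⟩
  algebraMap_mem' := by
    intro c f
    refine ⟨(starRingEnd 𝕜) c • f, fun h => ?_⟩
    have : (algebraMap 𝕜 (E →L[𝕜] E) c) h = c • h := by
      simp [Algebra.algebraMap_eq_smul_one]
    rw [this, map_smul, map_smul, inner_smul_left, inner_smul_right]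

/-- The linear operator `f ↦ T⁺ f`, where `T⁺ f` is the unique `g` in `E` such that
`⟪T h, f⟫ = ⟪h, g⟫` for all `h` in `E`. -/
noncomputable def plusLinear (ι : DenseInclusion 𝕜 E L) (T : ι.properAlgebra) : E →ₗ[𝕜] E where
  toFun f := (T.2 f).choose
  map_add' f₁ f₂ := ι.ext_inner fun h => by
    rw [← (T.2 (f₁ + f₂)).choose_spec h, map_add, map_add, inner_add_right, inner_add_right,
      (T.2 f₁).choose_spec h, (T.2 f₂).choose_spec h]
  map_smul' c f := ι.ext_inner fun h => by
    rw [← (T.2 (c • f)).choose_spec h, RingHom.id_apply, map_smul, map_smul, inner_smul_right,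
      inner_smul_right, (T.2 f).choose_spec h]

theorem inner_plusLinear (ι : DenseInclusion 𝕜 E L) (T : ι.properAlgebra) (h f : E) :
    inner 𝕜 (ι.incl ((T : E →L[𝕜] E) h)) (ι.incl f)
      = inner 𝕜 (ι.incl h) (ι.incl (ι.plusLinear T f)) :=
  (T.2 f).choose_spec h

/-- The adjoint operator `T⁺` of a proper operator `T`. It is bounded by the closed graph
theorem. -/
noncomputable def plusCLM [CompleteSpace E] (ι : DenseInclusion 𝕜 E L) (T : ι.properAlgebra) :
    E →L[𝕜] E :=
  ContinuousLinearMap.ofSeqClosedGraph (g := ι.plusLinear T) (by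
    intro u x y hu hgu
    refine ι.ext_inner fun h => ?_
    rw [← ι.inner_plusLinear T h x]
    have h1 : Tendsto (fun n => inner 𝕜 (ι.incl h) (ι.incl (ι.plusLinear T (u n)))) atTop
        (𝓝 (inner 𝕜 (ι.incl h) (ι.incl y))) :=
      tendsto_const_nhds.inner ((ι.incl.continuous.tendsto y).comp hgu)
    have h2 : Tendsto (fun n => inner 𝕜 (ι.incl ((T : E →L[𝕜] E) h)) (ι.incl (u n))) atTop
        (𝓝 (inner 𝕜 (ι.incl ((T : E →L[𝕜] E) h)) (ι.incl x))) :=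
      tendsto_const_nhds.inner ((ι.incl.continuous.tendsto x).comp hu)
    simp only [ι.inner_plusLinear T h (u _)] at h2
    exact tendsto_nhds_unique h1 h2)

theorem inner_plusCLM [CompleteSpace E] (ι : DenseInclusion 𝕜 E L) (T : ι.properAlgebra)
    (h f : E) :
    inner 𝕜 (ι.incl ((T : E →L[𝕜] E) h)) (ι.incl f)
      = inner 𝕜 (ι.incl h) (ι.incl (ι.plusCLM T f)) :=
  (T.2 f).choose_spec h

/-- The involution `T ↦ T⁺` of the algebra `𝔓` of proper operators. -/
noncomputable def plus [CompleteSpace E] (ι : DenseInclusion 𝕜 E L) (T : ι.properAlgebra) :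
    ι.properAlgebra :=
  ⟨ι.plusCLM T, fun f => ⟨(T : E →L[𝕜] E) f, fun h => by
    rw [← inner_conj_symm, ← ι.inner_plusCLM T f h, inner_conj_symm]⟩⟩

/-- The norm `‖T‖_𝔓 = ‖T‖ + ‖T⁺‖` of the algebra of proper operators. -/
noncomputable def properNorm [CompleteSpace E] (ι : DenseInclusion 𝕜 E L)
    (T : ι.properAlgebra) : ℝ :=
  ‖(T : E →L[𝕜] E)‖ + ‖(ι.plus T : E →L[𝕜] E)‖

/-- `S^⊥ ∩ E`: the vectors of `E` that are orthogonal in `L` to the subspace `S` of `E`. -/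
def perp (ι : DenseInclusion 𝕜 E L) (S : Submodule 𝕜 E) : Submodule 𝕜 E :=
  (S.map (ι.incl : E →ₗ[𝕜] L))ᗮ.comap (ι.incl : E →ₗ[𝕜] L)

theorem inner_eq_zero_of_mem_perp (ι : DenseInclusion 𝕜 E L) {S : Submodule 𝕜 E} {s f : E}
    (hs : s ∈ S) (hf : f ∈ ι.perp S) : inner 𝕜 (ι.incl s) (ι.incl f) = 0 :=
  (Submodule.mem_orthogonal _ _).mp hf _ (Submodule.mem_map_of_mem hs)

/-- A proper subspace: a closed subspace of `E` that is the range of a proper projection. -/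
def IsProperSubspace (ι : DenseInclusion 𝕜 E L) (S : Submodule 𝕜 E) : Prop :=
  IsClosed (S : Set E) ∧
    ∃ Q : ι.properAlgebra, IsIdempotentElem Q ∧ (Q : E →L[𝕜] E).range = S

/-- A compatible subspace: a closed subspace of `E` that is the range of a proper projection `Q`
with `Q⁺ = Q`. -/
def IsCompatible [CompleteSpace E] (ι : DenseInclusion 𝕜 E L) (S : Submodule 𝕜 E) : Prop :=
  IsClosed (S : Set E) ∧
    ∃ Q : ι.properAlgebra, IsIdempotentElem Q ∧ ι.plus Q = Q ∧ (Q : E →L[𝕜] E).range = S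

/-- `T` is a proper companion of `S`: both are closed subspaces of `E`, and `E` is the direct sum
of `S` and `T`, and also the direct sum of `S^⊥ ∩ E` and `T^⊥ ∩ E`. -/
structure IsProperCompanion (ι : DenseInclusion 𝕜 E L) (S T : Submodule 𝕜 E) : Prop where
  isClosed_left : IsClosed (S : Set E)
  isClosed_right : IsClosed (T : Set E)
  isCompl : IsCompl S T
  isCompl_perp : IsCompl (ι.perp S) (ι.perp T)

section Projection

variable [CompleteSpace E]

theorem IsProperCompanion.isTopCompl {ι : DenseInclusion 𝕜 E L} {S T : Submodule 𝕜 E}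
    (h : ι.IsProperCompanion S T) : Submodule.IsTopCompl T S :=
  Submodule.IsCompl.isTopCompl_of_isClosed h.isCompl.symm h.isClosed_right h.isClosed_left

theorem IsProperCompanion.isProper_projectionL {ι : DenseInclusion 𝕜 E L} {S T : Submodule 𝕜 E}
    (h : ι.IsProperCompanion S T) : ι.IsProper (T.projectionL S h.isTopCompl) := by
  intro f
  have hf : f ∈ ι.perp S ⊔ ι.perp T := by rw [h.isCompl_perp.sup_eq_top]; trivial
  obtain ⟨a, ha, b, hb, rfl⟩ := Submodule.mem_sup.mp hf
  refine ⟨a, fun x => ?_⟩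
  have hT : T.projectionL S h.isTopCompl x ∈ T := Submodule.projectionL_apply_mem _ x
  have hS : x - T.projectionL S h.isTopCompl x ∈ S := by
    have := Submodule.projectionL_add_projectionL_eq_self h.isTopCompl x
    rw [sub_eq_of_eq_add' this.symm]
    exact Submodule.projectionL_apply_mem _ x
  have e : inner 𝕜 (ι.incl (x - T.projectionL S h.isTopCompl x)) (ι.incl a) = 0 :=
    ι.inner_eq_zero_of_mem_perp hS ha
  rw [map_sub, inner_sub_left, sub_eq_zero] at e
  rw [map_add, inner_add_right, ι.inner_eq_zero_of_mem_perp hT hb, add_zero, e]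

/-- The projection `P_{T // S}` with range `T` and nullspace `S`, as an element of the algebra
`𝔓`, for a proper companion `T` of `S`. -/
noncomputable def companionProj (ι : DenseInclusion 𝕜 E L) {S T : Submodule 𝕜 E}
    (h : ι.IsProperCompanion S T) : ι.properAlgebra :=
  ⟨T.projectionL S h.isTopCompl, h.isProper_projectionL⟩

/-- The metric `d(T₁, T₂) = ‖P_{T₁ // S} - P_{T₂ // S}‖_𝔓` on the proper companions of `S`. -/
noncomputable def companionDist (ι : DenseInclusion 𝕜 E L) {S T₁ T₂ : Submodule 𝕜 E}
    (h₁ : ι.IsProperCompanion S T₁) (h₂ : ι.IsProperCompanion S T₂) : ℝ :=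
  ι.properNorm (ι.companionProj h₁ - ι.companionProj h₂)

end Projection

end DenseInclusion

namespace DenseInclusion

section Range

variable {𝕜 E L : Type*} [RCLike 𝕜] [NormedAddCommGroup E] [NormedSpace 𝕜 E]
  [NormedAddCommGroup L] [InnerProductSpace 𝕜 L]

/-! For a projection `Q` in `𝔓` put `X = Q + Q⁺ - 1`, a symmetric element. If `X` is invertible, `Q
X⁻¹` is the symmetric projection onto the range of `Q` (`isCompatible_range_of_isUnit`). Conversely,
if range and nullspace of `Q` are compatible, with symmetric projections `P` and `R`, then `X⁻¹ = P
- R` (`isUnit_of_isCompatible`). Invertibility need only be tested in the bounded operators on `E`,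
because the inverse of a symmetric operator is symmetric, hence proper.

Apply this to `Q = P_{T//S}`. For (i), the invertible operators are open and `X` depends
continuously on `Q` in the `𝔓`-norm. For (ii), replacing `Q` by `G Q G⁻¹` changes `X` by a compact
operator; the new `X` is always injective (`injective_add_plus_sub_one`), so the Fredholm
alternative makes it invertible. -/

theorem coe_isIdempotentElem {ι : DenseInclusion 𝕜 E L} {Q : ι.properAlgebra}
    (hQ : IsIdempotentElem Q) : IsIdempotentElem (Q : E →L[𝕜] E) :=
  congrArg Subtype.val hQ

theorem mul_eq_of_range_le {ι : DenseInclusion 𝕜 E L} {P Q : ι.properAlgebra}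
    (hP : IsIdempotentElem P) (h : (Q : E →L[𝕜] E).range ≤ (P : E →L[𝕜] E).range) :
    P * Q = Q := by
  refine Subtype.ext <| ContinuousLinearMap.ext fun x => ?_
  obtain ⟨y, hy⟩ := h ⟨x, rfl⟩
  have hy : (P : E →L[𝕜] E) y = (Q : E →L[𝕜] E) x := hy
  change (P : E →L[𝕜] E) ((Q : E →L[𝕜] E) x) = (Q : E →L[𝕜] E) x
  rw [← hy]
  exact DFunLike.congr_fun (coe_isIdempotentElem hP) y

end Range

/-! ### The involution and the operator `Q + Q⁺ - 1` -/

section Involution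

variable {𝕜 E L : Type*} [RCLike 𝕜] [NormedAddCommGroup E] [NormedSpace 𝕜 E] [CompleteSpace E]
  [NormedAddCommGroup L] [InnerProductSpace 𝕜 L]

theorem inner_plus (ι : DenseInclusion 𝕜 E L) (A : ι.properAlgebra) (h f : E) :
    inner 𝕜 (ι.incl ((A : E →L[𝕜] E) h)) (ι.incl f)
      = inner 𝕜 (ι.incl h) (ι.incl ((ι.plus A : E →L[𝕜] E) f)) :=
  ι.inner_plusCLM A h f

theorem plus_eq_of_inner (ι : DenseInclusion 𝕜 E L) {A B : ι.properAlgebra}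
    (H : ∀ h f : E, inner 𝕜 (ι.incl ((A : E →L[𝕜] E) h)) (ι.incl f)
      = inner 𝕜 (ι.incl h) (ι.incl ((B : E →L[𝕜] E) f))) : ι.plus A = B :=
  Subtype.ext <| ContinuousLinearMap.ext fun f => ι.ext_inner fun h => by
    rw [← ι.inner_plus, H]

theorem plus_add (ι : DenseInclusion 𝕜 E L) (A B : ι.properAlgebra) :
    ι.plus (A + B) = ι.plus A + ι.plus B :=
  ι.plus_eq_of_inner fun h f => by
    simp only [Subalgebra.coe_add, add_apply, map_add, inner_add_left, inner_add_right,
      inner_plus]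

theorem plus_sub (ι : DenseInclusion 𝕜 E L) (A B : ι.properAlgebra) :
    ι.plus (A - B) = ι.plus A - ι.plus B := by
  rw [eq_sub_iff_add_eq, ← plus_add, sub_add_cancel]

theorem plus_mul (ι : DenseInclusion 𝕜 E L) (A B : ι.properAlgebra) :
    ι.plus (A * B) = ι.plus B * ι.plus A :=
  ι.plus_eq_of_inner fun h f => by
    simp only [Subalgebra.coe_mul, mul_apply_eq_comp, inner_plus]

theorem plus_one (ι : DenseInclusion 𝕜 E L) : ι.plus 1 = 1 :=
  ι.plus_eq_of_inner fun _ _ => rfl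

theorem plus_plus (ι : DenseInclusion 𝕜 E L) (A : ι.properAlgebra) : ι.plus (ι.plus A) = A :=
  ι.plus_eq_of_inner fun h f => by
    rw [← inner_conj_symm, ← ι.inner_plus A f h, inner_conj_symm]

/-- A self-adjoint proper operator that is invertible on `E` is invertible in `𝔓`. -/
theorem isUnit_of_plus_eq_self (ι : DenseInclusion 𝕜 E L) {X : ι.properAlgebra}
    (hX : ι.plus X = X) (hu : IsUnit (X : E →L[𝕜] E)) : IsUnit X := by
  obtain ⟨Y, h₁, h₂⟩ := isUnit_iff_exists.mp hu
  have hXY (f : E) : (X : E →L[𝕜] E) (Y f) = f := DFunLike.congr_fun h₁ f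
  -- `Y` is its own adjoint: `⟪Y h, f⟫ = ⟪Y h, X Y f⟫ = ⟪X Y h, Y f⟫ = ⟪h, Y f⟫`.
  have hY : ι.IsProper Y := fun f => ⟨Y f, fun h => by
    conv_lhs => rw [← hXY f]
    conv_rhs => rw [← hXY h]
    rw [ι.inner_plus X, hX]⟩
  exact isUnit_iff_exists.mpr ⟨⟨Y, hY⟩, Subtype.ext h₁, Subtype.ext h₂⟩

theorem plus_eq_self_of_mul_eq_one (ι : DenseInclusion 𝕜 E L) {X Y : ι.properAlgebra}
    (hX : ι.plus X = X) (h₁ : X * Y = 1) : ι.plus Y = Y := by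
  have h : ι.plus Y * X = 1 := by rw [← hX, ← plus_mul, h₁, plus_one]
  exact left_inv_eq_right_inv h h₁

theorem plus_add_plus_sub_one (ι : DenseInclusion 𝕜 E L) (Q : ι.properAlgebra) :
    ι.plus (Q + ι.plus Q - 1) = Q + ι.plus Q - 1 := by
  rw [plus_sub, plus_add, plus_plus, plus_one, add_comm (ι.plus Q)]

theorem isIdempotentElem_plus (ι : DenseInclusion 𝕜 E L) {Q : ι.properAlgebra}
    (hQ : IsIdempotentElem Q) : IsIdempotentElem (ι.plus Q) := by
  rw [IsIdempotentElem, ← plus_mul, hQ.eq]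

/-- If `Q + Q⁺ - 1` is invertible on `E`, the range of the projection `Q` is compatible. -/
theorem isCompatible_range_of_isUnit (ι : DenseInclusion 𝕜 E L) {Q : ι.properAlgebra}
    (hQ : IsIdempotentElem Q) (hu : IsUnit ((Q + ι.plus Q - 1 : ι.properAlgebra) : E →L[𝕜] E)) :
    ι.IsCompatible (Q : E →L[𝕜] E).range := by
  have hX := ι.plus_add_plus_sub_one Q
  obtain ⟨Y, h₁, h₂⟩ := isUnit_iff_exists.mp (ι.isUnit_of_plus_eq_self hX hu)
  have hY := ι.plus_eq_self_of_mul_eq_one hX h₁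
  have hQ' : ι.plus Q * ι.plus Q = ι.plus Q := ι.isIdempotentElem_plus hQ
  -- Both sides equal `Q Q⁺`. Thus `X` intertwines `Q` and `Q⁺`, and so does its inverse `Y`; this
  -- makes `Q Y` symmetric and idempotent.
  have e₁ : Q * (Q + ι.plus Q - 1) = (Q + ι.plus Q - 1) * ι.plus Q := by
    simp only [mul_add, mul_sub, add_mul, sub_mul, hQ.eq, hQ', mul_one, one_mul]
    abel
  have e₂ : ι.plus Q * (Q + ι.plus Q - 1) = (Q + ι.plus Q - 1) * Q := by
    simp only [mul_add, mul_sub, add_mul, sub_mul, hQ.eq, hQ', mul_one, one_mul]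
    abel
  have f₂ : Y * ι.plus Q = Q * Y := by
    calc Y * ι.plus Q = Y * (ι.plus Q * (Q + ι.plus Q - 1)) * Y := by
          rw [mul_assoc, mul_assoc, h₁, mul_one]
      _ = Q * Y := by rw [e₂, ← mul_assoc, h₂, one_mul]
  have f₁ : ι.plus Q * Y = Y * Q := by
    calc ι.plus Q * Y = Y * ((Q + ι.plus Q - 1) * ι.plus Q) * Y := by
          rw [← mul_assoc, h₂, one_mul]
      _ = Y * Q := by rw [← e₁, mul_assoc, mul_assoc, h₁, mul_one]
  have hs : (Q + ι.plus Q - 1) * Y * Y = Y := by rw [h₁, one_mul]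
  have hidem : IsIdempotentElem (Q * Y) := by
    calc Q * Y * (Q * Y) = Q * (Y * Q) * Y := by simp only [mul_assoc]
      _ = Q * ι.plus Q * Y * Y := by rw [← f₁]; simp only [mul_assoc]
      _ = Q * (Q + ι.plus Q - 1) * Y * Y := by
          congr 2
          simp only [mul_add, mul_sub, hQ.eq, mul_one]
          abel
      _ = Q * Y := by rw [mul_assoc, mul_assoc, ← mul_assoc _ Y Y, hs]
  refine ⟨ContinuousLinearMap.IsIdempotentElem.isClosed_range (coe_isIdempotentElem hQ), Q * Y, hidem, ?_, le_antisymm ?_ ?_⟩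
  · rw [plus_mul, hY, f₂]
  · rintro _ ⟨x, rfl⟩
    exact ⟨(Y : E →L[𝕜] E) x, rfl⟩
  · rintro _ ⟨x, rfl⟩
    refine ⟨((Q + ι.plus Q - 1 : ι.properAlgebra) : E →L[𝕜] E) x, ?_⟩
    have : Q * Y * (Q + ι.plus Q - 1) = Q := by rw [mul_assoc, h₂, mul_one]
    exact DFunLike.congr_fun (congrArg Subtype.val this) x

/-- If the range and the nullspace of a projection `Q` are both compatible, then `Q + Q⁺ - 1` is
invertible: its inverse is the difference of the two self-adjoint projections. -/
theorem isUnit_of_isCompatible (ι : DenseInclusion 𝕜 E L) {Q : ι.properAlgebra}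
    (hQ : IsIdempotentElem Q) (hr : ι.IsCompatible (Q : E →L[𝕜] E).range)
    (hk : ι.IsCompatible ((1 - Q : ι.properAlgebra) : E →L[𝕜] E).range) :
    IsUnit (Q + ι.plus Q - 1) := by
  obtain ⟨-, P, hP, hPp, hPr⟩ := hr
  obtain ⟨-, R, hR, hRp, hRr⟩ := hk
  -- Projections with equal range absorb each other; taking adjoints gives the matching identities
  -- for `Q⁺`.
  have a₁ : P * Q = Q := mul_eq_of_range_le hP hPr.ge
  have a₂ : Q * P = P := mul_eq_of_range_le hQ hPr.le
  have b₁ : R * (1 - Q) = 1 - Q := mul_eq_of_range_le hR hRr.ge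
  have b₂ : (1 - Q) * R = R := mul_eq_of_range_le hQ.one_sub hRr.le
  have a₃ : ι.plus Q * P = ι.plus Q := by simpa only [plus_mul, hPp] using congrArg ι.plus a₁
  have a₄ : P * ι.plus Q = P := by simpa only [plus_mul, hPp] using congrArg ι.plus a₂
  have b₃ : (1 - ι.plus Q) * R = 1 - ι.plus Q := by
    simpa only [plus_mul, hRp, plus_sub, plus_one] using congrArg ι.plus b₁
  have b₄ : R * (1 - ι.plus Q) = R := by
    simpa only [plus_mul, hRp, plus_sub, plus_one] using congrArg ι.plus b₂
  refine isUnit_iff_exists.mpr ⟨P - R, ?_, ?_⟩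
  · calc (Q + ι.plus Q - 1) * (P - R)
        = Q * P + ι.plus Q * P - P + ((1 - Q) * R + (1 - ι.plus Q) * R - R) := by
          simp only [mul_sub, add_mul, sub_mul, one_mul]
          abel
      _ = 1 := by rw [a₂, a₃, b₂, b₃]; abel
  · calc (P - R) * (Q + ι.plus Q - 1)
        = P * Q + P * ι.plus Q - P + (R * (1 - Q) + R * (1 - ι.plus Q) - R) := by
          simp only [mul_add, mul_sub, sub_mul, mul_one]
          abel
      _ = 1 := by rw [a₁, a₄, b₁, b₄]; abel

/-- For every projection `Q` in `𝔓`, the operator `Q + Q⁺ - 1` is injective. -/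
theorem injective_add_plus_sub_one (ι : DenseInclusion 𝕜 E L) {Q : ι.properAlgebra}
    (hQ : IsIdempotentElem Q) :
    Function.Injective ((Q + ι.plus Q - 1 : ι.properAlgebra) : E →L[𝕜] E) := by
  have hQQ (x : E) : (Q : E →L[𝕜] E) ((Q : E →L[𝕜] E) x) = (Q : E →L[𝕜] E) x :=
    DFunLike.congr_fun (coe_isIdempotentElem hQ) x
  have hpp (x : E) : (ι.plus Q : E →L[𝕜] E) ((ι.plus Q : E →L[𝕜] E) x)
      = (ι.plus Q : E →L[𝕜] E) x :=
    DFunLike.congr_fun (coe_isIdempotentElem (ι.isIdempotentElem_plus hQ)) x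
  have hzero {x : E} (hx : inner 𝕜 (ι.incl x) (ι.incl x) = 0) : x = 0 :=
    ι.injective (by rw [map_zero]; exact inner_self_eq_zero.mp hx)
  refine (injective_iff_map_eq_zero _).mpr fun f hf => ?_
  have hf : (Q : E →L[𝕜] E) f + (ι.plus Q : E →L[𝕜] E) f - f = 0 := hf
  -- As `Q f = (1 - Q⁺) f`, it is killed by `Q⁺`, so `⟪Q f, Q f⟫ = ⟪Q f, Q⁺ Q f⟫ = 0`. Then `Q⁺ f =
  -- f` and `⟪f, f⟫ = ⟪Q f, f⟫ = 0`.
  have hu : (ι.plus Q : E →L[𝕜] E) ((Q : E →L[𝕜] E) f) = 0 := by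
    have : (Q : E →L[𝕜] E) f = f - (ι.plus Q : E →L[𝕜] E) f := by
      rw [← sub_eq_zero, ← hf]; abel
    rw [this, map_sub, hpp, sub_self]
  have hQf : (Q : E →L[𝕜] E) f = 0 := hzero <| by
    conv_lhs => rw [← hQQ f]
    rw [hQQ, ι.inner_plus, hu, map_zero, inner_zero_right]
  have hpf : (ι.plus Q : E →L[𝕜] E) f = f := by
    rw [← sub_eq_zero, ← hf, hQf, zero_add]
  refine hzero ?_
  nth_rewrite 2 [← hpf]
  rw [← ι.inner_plus, hQf, map_zero, inner_zero_left]

end Involution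

end DenseInclusion

/-- The Fredholm alternative for compact perturbations of an invertible operator. -/
theorem IsUnit.of_injective_of_isCompactOperator_sub {𝕜 E : Type*} [NontriviallyNormedField 𝕜]
    [NormedAddCommGroup E] [NormedSpace 𝕜 E] [CompleteSpace E] {A B : E →L[𝕜] E}
    (hA : IsUnit A) (hK : IsCompactOperator (B - A)) (hB : Function.Injective B) : IsUnit B := by
  obtain ⟨C, hAC, hCA⟩ := isUnit_iff_exists.mp hA
  have hCA' (x : E) : C (A x) = x := DFunLike.congr_fun hCA x
  have hK' : IsCompactOperator (-(C * (B - A))) := (hK.clm_comp C).neg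
  -- Now `C * B` is the identity minus a compact operator; were `1` an eigenvalue of the latter, `B`
  -- would kill an eigenvector.
  have hmul : C * B = 1 - -(C * (B - A)) := by rw [mul_sub, hCA]; abel
  have hCB : IsUnit (C * B) := by
    refine (hK'.hasEigenvalue_or_mem_resolventSet one_ne_zero).elim (fun h => ?_) fun h => ?_
    · obtain ⟨v, hv⟩ := h.exists_hasEigenvector
      refine absurd ?_ hv.2
      have hv' : (-(C * (B - A))) v = v := by simpa using hv.apply_eq_smul
      have hz : C (B v) = 0 := by
        calc C (B v) = v - (-(C * (B - A))) v := DFunLike.congr_fun hmul v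
          _ = 0 := by rw [hv', sub_self]
      have hAC' : A (C (B v)) = B v := DFunLike.congr_fun hAC (B v)
      rw [hz, map_zero] at hAC'
      exact hB (by rw [← hAC', map_zero])
    · rw [spectrum.mem_resolventSet_iff, map_one, ← hmul] at h
      exact h
  have : B = A * (C * B) := by rw [← mul_assoc, hAC, one_mul]
  rw [this]
  exact hA.mul hCB

namespace DenseInclusion

/-! ### Proper companions and the two perturbation results -/

section Companion

variable {𝕜 E L : Type*} [RCLike 𝕜] [NormedAddCommGroup E] [NormedSpace 𝕜 E] [CompleteSpace E]
  [NormedAddCommGroup L] [InnerProductSpace 𝕜 L]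

theorem isIdempotentElem_companionProj (ι : DenseInclusion 𝕜 E L) {S T : Submodule 𝕜 E}
    (h : ι.IsProperCompanion S T) : IsIdempotentElem (ι.companionProj h) :=
  Subtype.ext (Submodule.isIdempotentElem_projectionL h.isTopCompl)

theorem range_companionProj (ι : DenseInclusion 𝕜 E L) {S T : Submodule 𝕜 E}
    (h : ι.IsProperCompanion S T) : (ι.companionProj h : E →L[𝕜] E).range = T :=
  Submodule.range_projectionL h.isTopCompl

theorem range_one_sub_companionProj (ι : DenseInclusion 𝕜 E L) {S T : Submodule 𝕜 E}
    (h : ι.IsProperCompanion S T) :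
    ((1 - ι.companionProj h : ι.properAlgebra) : E →L[𝕜] E).range = S := by
  have : ((1 - ι.companionProj h : ι.properAlgebra) : E →L[𝕜] E)
      = S.projectionL T h.isTopCompl.symm := ContinuousLinearMap.ext fun x =>
    sub_eq_of_eq_add' (Submodule.projectionL_add_projectionL_eq_self h.isTopCompl x).symm
  rw [this]
  exact Submodule.range_projectionL h.isTopCompl.symm

theorem isUnit_companionProj_add_plus_sub_one (ι : DenseInclusion 𝕜 E L) {S T : Submodule 𝕜 E}
    (h : ι.IsProperCompanion S T) (hS : ι.IsCompatible S) (hT : ι.IsCompatible T) :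
    IsUnit ((ι.companionProj h + ι.plus (ι.companionProj h) - 1 : ι.properAlgebra) :
      E →L[𝕜] E) :=
  (ι.isUnit_of_isCompatible (ι.isIdempotentElem_companionProj h)
    (by rwa [range_companionProj]) (by rwa [range_one_sub_companionProj])).map
    ι.properAlgebra.subtype

/-- The companions of `S` close to a compatible one are compatible. -/
theorem exists_isCompatible_of_companionDist_lt (ι : DenseInclusion 𝕜 E L) {S T : Submodule 𝕜 E}
    (h : ι.IsProperCompanion S T) (hS : ι.IsCompatible S) (hT : ι.IsCompatible T) :
    ∃ r : ℝ, 0 < r ∧ ∀ (T₁ : Submodule 𝕜 E) (h₁ : ι.IsProperCompanion S T₁),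
      ι.companionDist h h₁ < r → ι.IsCompatible T₁ := by
  obtain ⟨r, hr, hball⟩ := Metric.isOpen_iff.mp (Units.isOpen (R := E →L[𝕜] E)) _
    (ι.isUnit_companionProj_add_plus_sub_one h hS hT)
  refine ⟨r, hr, fun T₁ h₁ hd => ?_⟩
  have hu := ι.isCompatible_range_of_isUnit (ι.isIdempotentElem_companionProj h₁) (hball ?_)
  · rwa [range_companionProj] at hu
  · rw [Metric.mem_ball, dist_comm, dist_eq_norm]
    refine lt_of_le_of_lt ?_ hd
    rw [companionDist, properNorm]
    -- The change in `X` is `D + D⁺` with `D` the difference of the projections, so the `𝔓`-norm of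
    -- `D` bounds it.
    refine le_trans (le_of_eq ?_) (norm_add_le _ _)
    rw [← Subalgebra.coe_sub, ← Subalgebra.coe_add, plus_sub]
    congr 2
    abel

/-- Conjugating a projection with compatible range and nullspace by a unit of `𝔓` that is, together
with its adjoint, a compact perturbation of the identity, gives a projection with compatible
range. -/
theorem isCompatible_map_range_of_isCompactOperator (ι : DenseInclusion 𝕜 E L)
    {Q : ι.properAlgebra} (hQ : IsIdempotentElem Q)
    (hu : IsUnit ((Q + ι.plus Q - 1 : ι.properAlgebra) : E →L[𝕜] E)) (G : (ι.properAlgebra)ˣ)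
    (hG : IsCompactOperator (((G : ι.properAlgebra) - 1 : ι.properAlgebra) : E →L[𝕜] E))
    (hG' : IsCompactOperator ((ι.plus (G : ι.properAlgebra) - 1 : ι.properAlgebra) : E →L[𝕜] E)) :
    ι.IsCompatible ((Q : E →L[𝕜] E).range.map
      (((G : ι.properAlgebra) : E →L[𝕜] E) : E →ₗ[𝕜] E)) := by
  set g : ι.properAlgebra := ((G : (ι.properAlgebra)ˣ) : ι.properAlgebra)
  set k : ι.properAlgebra := ((G⁻¹ : (ι.properAlgebra)ˣ) : ι.properAlgebra)
  have hgk : g * k = 1 := G.mul_inv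
  have hkg : k * g = 1 := G.inv_mul
  have hgk' : ι.plus k * ι.plus g = 1 := by rw [← plus_mul, hgk, plus_one]
  have hidem : IsIdempotentElem (g * Q * k) := by
    calc g * Q * k * (g * Q * k) = g * Q * (k * g) * Q * k := by simp only [mul_assoc]
      _ = g * Q * k := by rw [hkg, mul_one, mul_assoc g, hQ.eq]
  have hrange : ((g * Q * k : ι.properAlgebra) : E →L[𝕜] E).range
      = (Q : E →L[𝕜] E).range.map ((g : E →L[𝕜] E) : E →ₗ[𝕜] E) := by
    apply le_antisymm
    · rintro _ ⟨x, rfl⟩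
      exact ⟨_, ⟨(k : E →L[𝕜] E) x, rfl⟩, rfl⟩
    · rintro _ ⟨_, ⟨x, rfl⟩, rfl⟩
      have : g * Q * k * g = g * Q := by rw [mul_assoc, hkg, mul_one]
      exact ⟨(g : E →L[𝕜] E) x, DFunLike.congr_fun (congrArg Subtype.val this) x⟩
  -- Since `k * g = 1`, `g Q k - Q` is the commutator of `g - 1` with `Q k`. With the adjoint part,
  -- every term contains `g - 1` or `g⁺ - 1`.
  have hdiff : (g * Q * k + ι.plus (g * Q * k) - 1) - (Q + ι.plus Q - 1)
      = ((g - 1) * (Q * k) - Q * k * (g - 1))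
        + (ι.plus k * ι.plus Q * (ι.plus g - 1) - ι.plus k * (ι.plus g - 1) * ι.plus Q) := by
    have e₁ : (g - 1) * (Q * k) - Q * k * (g - 1) = g * Q * k - Q * (k * g) := by simp only [mul_sub, sub_mul, mul_one, one_mul, mul_assoc]; abel
    have e₂ : ι.plus k * ι.plus Q * (ι.plus g - 1) - ι.plus k * (ι.plus g - 1) * ι.plus Q
        = ι.plus k * (ι.plus Q * ι.plus g) - ι.plus k * ι.plus g * ι.plus Q := by
      simp only [mul_sub, sub_mul, mul_one, mul_assoc]
      abel
    rw [e₁, e₂, hkg, hgk', plus_mul, plus_mul]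
    simp only [mul_one, one_mul, mul_assoc]
    abel
  have hcomp : IsCompactOperator
      (((g * Q * k + ι.plus (g * Q * k) - 1 : ι.properAlgebra) : E →L[𝕜] E)
        - ((Q + ι.plus Q - 1 : ι.properAlgebra) : E →L[𝕜] E)) := by
    rw [← Subalgebra.coe_sub, hdiff]
    have c₁ := hG.comp_clm ((Q * k : ι.properAlgebra) : E →L[𝕜] E)
    have c₂ := hG.clm_comp ((Q * k : ι.properAlgebra) : E →L[𝕜] E)
    have c₃ := hG'.clm_comp ((ι.plus k * ι.plus Q : ι.properAlgebra) : E →L[𝕜] E)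
    have c₄ := (hG'.clm_comp (ι.plus k : E →L[𝕜] E)).comp_clm (ι.plus Q : E →L[𝕜] E)
    exact (c₁.sub c₂).add (c₃.sub c₄)
  rw [← hrange]
  exact ι.isCompatible_range_of_isUnit hidem
    (hu.of_injective_of_isCompactOperator_sub hcomp (ι.injective_add_plus_sub_one hidem))

end Companion

end DenseInclusion

theorem mainTheorem4 {𝕜 E L : Type*} [RCLike 𝕜]
    [NormedAddCommGroup E] [NormedSpace 𝕜 E] [CompleteSpace E]
    [NormedAddCommGroup L] [InnerProductSpace 𝕜 L] [CompleteSpace L]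
    (ι : DenseInclusion 𝕜 E L) (S T : Submodule 𝕜 E)
    (hS : ι.IsProperSubspace S) (hT : ι.IsProperCompanion S T)
    (hSc : ι.IsCompatible S) (hTc : ι.IsCompatible T) :
    (∃ r : ℝ, 0 < r ∧ ∀ (T₁ : Submodule 𝕜 E) (hT₁ : ι.IsProperCompanion S T₁),
      ι.companionDist hT hT₁ < r → ι.IsCompatible T₁) ∧
    (∀ G : (ι.properAlgebra)ˣ,
      IsCompactOperator ⇑(((G : ι.properAlgebra) : E →L[𝕜] E) - ContinuousLinearMap.id 𝕜 E) →
      IsCompactOperator ⇑((ι.plus (G : ι.properAlgebra) : E →L[𝕜] E) - ContinuousLinearMap.id 𝕜 E) →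
      ι.IsCompatible (S.map (((G : ι.properAlgebra) : E →L[𝕜] E) : E →ₗ[𝕜] E)) ∧
      ι.IsCompatible (T.map (((G : ι.properAlgebra) : E →L[𝕜] E) : E →ₗ[𝕜] E))) := by
  refine ⟨ι.exists_isCompatible_of_companionDist_lt hT hSc hTc, fun G hG hG' => ?_⟩
  have hQ := ι.isIdempotentElem_companionProj hT
  have hu := ι.isUnit_companionProj_add_plus_sub_one hT hSc hTc
  constructor
  · rw [← ι.range_one_sub_companionProj hT]
    refine ι.isCompatible_map_range_of_isCompactOperator hQ.one_sub ?_ G hG hG'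
    -- Passing to the complementary projection, with range `S`, only changes the sign of `X`.
    have : 1 - ι.companionProj hT + ι.plus (1 - ι.companionProj hT) - 1
        = -(ι.companionProj hT + ι.plus (ι.companionProj hT) - 1) := by
      rw [DenseInclusion.plus_sub, DenseInclusion.plus_one]; abel
    rw [this]
    exact hu.neg
  · conv => arg 2; arg 2; rw [← ι.range_companionProj hT]
    exact ι.isCompatible_map_range_of_isCompactOperator hQ hu G hG hG'
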